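/- Let $(X,\mathcal B)$ be a standard Borel space and let $Aut(X,\mathcal B)$ be the group of its Borel automorphisms. For $S,T\in Aut(X,\mathcal B)$ put $E(S,T)=\{x: Tx\ne Sx\}\cup\{x: T^{-1}x\neq S^{-1}x\}$, and let $\tau$ be the topology on $Aut(X,\mathcal B)$ with the base of sets $$U(T;\mu_1,\dots,\mu_n;\varepsilon)=\{S\in Aut(X,\mathcal B): \mu_i(E(S,T))<\varepsilon,\ i=1,\dots,n\},$$ where $T\in Aut(X,\mathcal B)$, $\mu_1,\dots,\mu_n$ are Borel probability measures on $X$, and $\varepsilon>0$. Let $T\in Aut(X,\mathcal B)$ be aperiodic (no periodic points) and non-smooth (no Borel set meets every $T$-orbit exactly once). A $T$-multitower $\eta$ is an at most countable family of pairwise disjoint $T$-towers $(B_0(j),TB_0(j),\dots,T^{n_j}B_0(j))$, $j\in J$, each consisting of pairwise disjoint sets (the atoms) over an uncountable Borel set $B_0(j)$; its support is the union of its atoms, and its rank is $|J|$. A multitower $\eta'$ refines $\eta$ if every atom of $\eta$ is a union of atoms of $\eta'$. $T$ has rank at most $r$ if there is a sequence $(\eta_n)$ of $T$-multitowers of rank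 at most $r$ such that $\eta_{n+1}$ refines $\eta_n$ for all $n$, the supports of the $\eta_n$ have union $X$, and the atoms of all the $\eta_n$ together generate $\mathcal B$. Let $\mathcal R(1)$ be the set of those $T$ that have rank at most $1$ but not rank at most $0$. Given integers $\lambda_t\ge 2$, $t\geq 0$, put $p_{-1}=1$, $p_t=\lambda_0\cdots\lambda_t$, and let $Z_\lambda=\{\sum_{i\ge 0}x_ip_{i-1}: 0\le x_i<\lambda_i\}$ be the compact group of $(p_t)$-adic numbers, with addition with carry. Let $\mathcal Od\subset Aut(X,\mathcal B)$ be the set of odometers, i.e. of the automorphisms that are Borel isomorphic to $z\mapsto z+1$ on $Z_\lambda$ for some such sequence $(\lambda_t)$. Then $\overline{\mathcal R(1)}^{\,\tau}=\overline{\mathcal Od}^{\,\tau}$. -/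

import Mathlib

open scoped Topology

namespace BorelAut

/-! ### The uniform topology on `Aut(X, B)` -/

/-- The set `E(S,T) = {x | T x ≠ S x} ∪ {x | T⁻¹ x ≠ S⁻¹ x}`. -/
def diffSet {X : Type*} [MeasurableSpace X] (S T : X ≃ᵐ X) : Set X :=
  {x | T x ≠ S x} ∪ {x | T.symm x ≠ S.symm x}

/-- The basic neighborhood `U(T; μ₁, …, μₙ; ε)`. -/
def basicNhd {X : Type*} [MeasurableSpace X] (T : X ≃ᵐ X) {n : ℕ}
    (μ : Fin n → MeasureTheory.ProbabilityMeasure X) (ε : ℝ) : Set (X ≃ᵐ X) :=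
  {S | ∀ i, ((μ i (diffSet S T) : NNReal) : ℝ) < ε}

/-- The uniform topology `τ` on the group of Borel automorphisms of `X`, generated by the sets
`U(T; μ₁, …, μₙ; ε)`. -/
abbrev tau (X : Type*) [MeasurableSpace X] : TopologicalSpace (X ≃ᵐ X) :=
  TopologicalSpace.generateFrom
    {U | ∃ (T : X ≃ᵐ X) (n : ℕ) (μ : Fin n → MeasureTheory.ProbabilityMeasure X) (ε : ℝ),
      0 < ε ∧ U = basicNhd T μ ε}

/-! ### Aperiodic and smooth automorphisms -/

/-- No point is periodic. -/
def IsAperiodic {X : Type*} [MeasurableSpace X] (T : X ≃ᵐ X) : Prop :=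
  ∀ x, x ∉ Function.periodicPts (T : X → X)

/-- `T` is smooth if some Borel set meets every `T`-orbit exactly once. -/
def IsSmooth {X : Type*} [MeasurableSpace X] (T : X ≃ᵐ X) : Prop :=
  ∃ A : Set X, MeasurableSet A ∧ ∀ x, ∃! y, y ∈ A ∧ Equiv.Perm.SameCycle T.toEquiv x y

/-! ### Multitowers and rank -/

/-- A `T`-multitower: a finite or countable disjoint collection of towers
`(B₀(j), T B₀(j), …, T ^ (n_j) B₀(j))` over uncountable Borel bases `B₀(j)`. -/
structure Multitower {X : Type*} [MeasurableSpace X] (T : X ≃ᵐ X) where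
  /-- the index set of the towers -/
  J : Type
  countable_J : Countable J
  /-- the base of each tower -/
  base : J → Set X
  /-- the index of the top level of each tower -/
  top : J → ℕ
  measurable_base : ∀ j, MeasurableSet (base j)
  uncountable_base : ∀ j, ¬ (base j).Countable
  /-- all the levels of all the towers are pairwise disjoint -/
  disjoint_levels : ∀ j i j' i', i ≤ top j → i' ≤ top j' → (j ≠ j' ∨ i ≠ i') →
    Disjoint ((T : X → X)^[i] '' base j) ((T : X → X)^[i'] '' base j')

/-- The atoms of a multitower: the levels of its towers. -/
def Multitower.atoms {X : Type*} [MeasurableSpace X] {T : X ≃ᵐ X} (η : Multitower T) :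
    Set (Set X) :=
  {A | ∃ (j : η.J) (i : ℕ), i ≤ η.top j ∧ A = (T : X → X)^[i] '' η.base j}

/-- The support of a multitower: the union of its atoms. -/
def Multitower.support {X : Type*} [MeasurableSpace X] {T : X ≃ᵐ X} (η : Multitower T) : Set X :=
  ⋃₀ η.atoms

/-- The rank of a multitower: the number of its towers. -/
noncomputable def Multitower.rank {X : Type*} [MeasurableSpace X] {T : X ≃ᵐ X}
    (η : Multitower T) : ℕ∞ :=
  ENat.card η.J

/-- `η'` refines `η`: every atom of `η` is a union of atoms of `η'`. The support of `η'` thus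
contains that of `η` and may be larger (there may be spacers), and the atoms of `η'` that meet
the support of `η` are contained in atoms of `η`. -/
def Multitower.Refines {X : Type*} [MeasurableSpace X] {T : X ≃ᵐ X} (η' η : Multitower T) : Prop :=
  ∀ A ∈ η.atoms, ∃ C ⊆ η'.atoms, A = ⋃₀ C

/-- `T` (aperiodic and not smooth) has rank at most `r`: there is a refining sequence of
multitowers of rank at most `r` whose supports exhaust `X` and whose atoms generate the Borel
σ-algebra. -/
def HasRankAtMost {X : Type*} [m : MeasurableSpace X] (T : X ≃ᵐ X) (r : ℕ) : Prop :=
  IsAperiodic T ∧ ¬ IsSmooth T ∧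
    ∃ η : ℕ → Multitower T,
      (∀ n, (η n).rank ≤ r) ∧
      (∀ n, (η (n + 1)).Refines (η n)) ∧
      (⋃ n, (η n).support) = Set.univ ∧
      MeasurableSpace.generateFrom (⋃ n, (η n).atoms) = m

/-- The set `R(r)` of automorphisms of rank `r`: rank at most `r` and not less. -/
def rankSet (X : Type*) [MeasurableSpace X] (r : ℕ) : Set (X ≃ᵐ X) :=
  {T | HasRankAtMost T r ∧ ∀ s < r, ¬ HasRankAtMost T s}

/-! ### Odometers -/

/-- The set of formal series `∑ xᵢ pᵢ₋₁` with digits `xᵢ ∈ {0, …, lᵢ - 1}`, where `p₋₁ = 1` and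
`pᵢ = l₀ l₁ ⋯ lᵢ`. It carries the product σ-algebra, which is the Borel σ-algebra of the
product topology. -/
abbrev AdicSeries (l : ℕ → ℕ) : Type := ∀ i, Fin (l i)

/-- The carry into digit `i` when `x` and `y` are added. -/
def carry {l : ℕ → ℕ} (x y : AdicSeries l) : ℕ → ℕ
  | 0 => 0
  | i + 1 => ((x i : ℕ) + (y i : ℕ) + carry x y i) / l i

/-- Addition of formal series, with carry to the right. -/
def adicAdd {l : ℕ → ℕ} (x y : AdicSeries l) : AdicSeries l := fun i =>
  ⟨((x i : ℕ) + (y i : ℕ) + carry x y i) % l i,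
    Nat.mod_lt _ (lt_of_le_of_lt (Nat.zero_le _) (x i).isLt)⟩

/-- The element `1 = 1 p₋₁ + 0 p₀ + 0 p₁ + ⋯`. -/
def adicOne {l : ℕ → ℕ} (hl : ∀ i, 2 ≤ l i) : AdicSeries l := fun i =>
  ⟨if i = 0 then 1 else 0, by have := hl i; split <;> omega⟩

/-- The set `Od` of odometers on `X`: the automorphisms that are Borel isomorphic to
`x ↦ x + 1` on the group of `(pₜ)`-adic numbers, for some sequence of integers `lₜ ≥ 2`. -/
def odometers (X : Type*) [MeasurableSpace X] : Set (X ≃ᵐ X) :=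
  {S | ∃ (l : ℕ → ℕ) (hl : ∀ i, 2 ≤ l i) (e : X ≃ᵐ AdicSeries l),
    ∀ x, e (S x) = adicAdd (e x) (adicOne hl)}

end BorelAut

/-!
The carry addition on formal series is addition modulo every `pₙ`, so an odometer factors onto the
rotations of `ℤ / pₙ`. The fibers of these factor maps form a refining sequence of single towers
without spacers, and the uniform probability measure is invariant and thus rules out smoothness:
odometers have rank one.

Conversely, if `T` has rank one, then for every finite measure there is a tower that exhausts `X` up
to a set of small measure and whose top has small measure, except possibly for one point, which `T`
sends to the base. The odometer with `lₜ = 2 (m + 1)` has a tower with the same number `m + 1` of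
levels and no spacers, and it can be transported to `X` so that it climbs the tower of `T` as
`T` does, except over an uncountable part of the base of small measure, which makes room for the
points outside the tower. It can also be made to agree with `T` at the exceptional top point.
-/

namespace BorelAut

open Filter Function PiNat ProbabilityTheory
open MeasureTheory hiding cylinder

section Cylinders

variable {E : ℕ → Type*}

lemma isPiSystem_cylinders :
    IsPiSystem {A : Set (∀ n, E n) | ∃ x n, A = cylinder x n} := by
  rintro _ ⟨x, n, rfl⟩ _ ⟨y, k, rfl⟩ ⟨z, hzx, hzy⟩
  rw [← mem_cylinder_iff_eq.1 hzx, ← mem_cylinder_iff_eq.1 hzy]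
  rcases le_total n k with h | h
  · exact ⟨z, k, Set.inter_eq_right.2 (cylinder_anti z h)⟩
  · exact ⟨z, n, Set.inter_eq_left.2 (cylinder_anti z h)⟩

lemma continuous_of_mem_cylinder [∀ n, TopologicalSpace (E n)] [∀ n, DiscreteTopology (E n)]
    {f : (∀ n, E n) → ∀ n, E n} (hf : ∀ n x y, x ∈ cylinder y n → f x ∈ cylinder (f y) n) :
    Continuous f :=
  continuous_pi fun i => continuous_discrete_rng.2 fun _ => isOpen_iff_mem_nhds.2 fun x hx =>
    mem_of_superset ((isOpen_cylinder E x (i + 1)).mem_nhds (self_mem_cylinder x _)) fun _ hy =>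
      (hf _ _ _ hy i i.lt_succ_self).trans hx

lemma generateFrom_cylinders [∀ n, Countable (E n)] [∀ n, MeasurableSpace (E n)]
    [∀ n, DiscreteMeasurableSpace (E n)] :
    MeasurableSpace.pi = MeasurableSpace.generateFrom
      {A : Set (∀ n, E n) | ∃ x n, A = cylinder x n} := by
  let : ∀ n, TopologicalSpace (E n) := fun _ => ⊥
  have : ∀ n, DiscreteTopology (E n) := fun _ => ⟨rfl⟩
  rw [← (isTopologicalBasis_cylinders E).borel_eq_generateFrom]
  exact BorelSpace.measurable_eq

lemma infinitePi_uniformOn_cylinder [∀ n, Fintype (E n)] [∀ n, Nonempty (E n)]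
    [∀ n, MeasurableSpace (E n)] [∀ n, MeasurableSingletonClass (E n)] (x : ∀ n, E n) (n : ℕ) :
    Measure.infinitePi (fun i => uniformOn (Set.univ : Set (E i))) (cylinder x n) =
      ∏ i ∈ Finset.range n, (Fintype.card (E i) : ENNReal)⁻¹ := by
  rw [cylinder_eq_pi, Measure.infinitePi_pi _ fun i _ => measurableSet_singleton _]
  simp [uniformOn_univ]

lemma measurePreserving_of_mem_cylinder_iff [∀ n, Finite (E n)] [∀ n, Nonempty (E n)]
    [∀ n, MeasurableSpace (E n)] [∀ n, DiscreteMeasurableSpace (E n)]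
    (f : (∀ n, E n) ≃ᵐ ∀ n, E n) (hf : ∀ n x y, f x ∈ cylinder (f y) n ↔ x ∈ cylinder y n) :
    MeasurePreserving f (Measure.infinitePi fun i => uniformOn (Set.univ : Set (E i)))
      (Measure.infinitePi fun i => uniformOn (Set.univ : Set (E i))) := by
  have := fun n => Fintype.ofFinite (E n)
  refine ⟨f.measurable, ext_of_generate_finite _ generateFrom_cylinders isPiSystem_cylinders ?_
    (by rw [f.map_apply, Set.preimage_univ])⟩
  rintro _ ⟨y, n, rfl⟩
  obtain ⟨z, rfl⟩ := f.surjective y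
  have hpre : f ⁻¹' cylinder (f z) n = cylinder z n := Set.ext fun x => hf n x z
  rw [f.map_apply, hpre, infinitePi_uniformOn_cylinder, infinitePi_uniformOn_cylinder]

end Cylinders

section AdicSeries

variable {l : ℕ → ℕ}

/-- The place value `pₙ₋₁ = l₀ ⋯ lₙ₋₁` of the digit `n`. -/
def place (l : ℕ → ℕ) (n : ℕ) : ℕ := ∏ i ∈ Finset.range n, l i

/-- The natural number whose digits are the first `n` digits of the formal series `x`. -/
def partialSum (x : AdicSeries l) (n : ℕ) : ℕ := ∑ i ∈ Finset.range n, (x i : ℕ) * place l i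

/-- The residue of the formal series `x` modulo `place l n`. The residues identify the formal series
with the inverse limit of the groups `ZMod (place l n)`, so that identities between series can be
checked modulo every `place l n`. -/
def residue (x : AdicSeries l) (n : ℕ) : ZMod (place l n) := partialSum x n

lemma place_succ (n : ℕ) : place l (n + 1) = place l n * l n := Finset.prod_range_succ _ _

lemma partialSum_succ (x : AdicSeries l) (n : ℕ) :
    partialSum x (n + 1) = partialSum x n + x n * place l n := Finset.sum_range_succ _ _

lemma two_pow_le_place (hl : ∀ i, 2 ≤ l i) (n : ℕ) : 2 ^ n ≤ place l n := by
  simpa [place] using Finset.pow_card_le_prod (Finset.range n) l 2 fun i _ => hl i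

lemma partialSum_lt (x : AdicSeries l) (n : ℕ) : partialSum x n < place l n := by
  induction n with
  | zero => simp [partialSum, place]
  | succ n ih =>
    calc partialSum x (n + 1) = partialSum x n + x n * place l n := partialSum_succ x n
      _ < (x n + 1) * place l n := by rw [add_one_mul, add_comm]; gcongr
      _ ≤ l n * place l n := by gcongr; exact (x n).isLt
      _ = place l (n + 1) := by rw [place_succ, mul_comm]

lemma partialSum_mod_place (x : AdicSeries l) (n : ℕ) :
    partialSum x (n + 1) % place l n = partialSum x n := by
  rw [partialSum_succ, Nat.add_mul_mod_self_right, Nat.mod_eq_of_lt (partialSum_lt x n)]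

lemma partialSum_div_place (x : AdicSeries l) (n : ℕ) :
    partialSum x (n + 1) / place l n = x n := by
  rw [partialSum_succ, Nat.add_mul_div_right _ _ (Nat.zero_lt_of_lt (partialSum_lt x n)),
    Nat.div_eq_of_lt (partialSum_lt x n), zero_add]

lemma partialSum_eq_iff {x y : AdicSeries l} {n : ℕ} :
    partialSum x n = partialSum y n ↔ x ∈ cylinder y n := by
  induction n with
  | zero => simp [partialSum]
  | succ n ih =>
    refine ⟨fun h i hi => ?_, fun h => Finset.sum_congr rfl fun i hi => ?_⟩
    · rcases Nat.lt_succ_iff_lt_or_eq.1 hi with hi | rfl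
      · refine ih.1 ?_ i hi
        rw [← partialSum_mod_place, h, partialSum_mod_place]
      · rw [Fin.ext_iff, ← partialSum_div_place, h, partialSum_div_place]
    · rw [h i (Finset.mem_range.1 hi)]

lemma residue_eq_iff {x y : AdicSeries l} {n : ℕ} :
    residue x n = residue y n ↔ x ∈ cylinder y n := by
  rw [← partialSum_eq_iff, residue, residue, ZMod.natCast_eq_natCast_iff]
  exact ⟨fun h => h.eq_of_lt_of_lt (partialSum_lt x n) (partialSum_lt y n), fun h => h ▸ rfl⟩

lemma ext_residue {x y : AdicSeries l} (h : ∀ n, residue x n = residue y n) : x = y :=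
  funext fun i => residue_eq_iff.1 (h (i + 1)) i i.lt_succ_self

lemma partialSum_adicAdd (x y : AdicSeries l) (n : ℕ) :
    partialSum (adicAdd x y) n + carry x y n * place l n = partialSum x n + partialSum y n := by
  induction n with
  | zero => simp [partialSum, carry]
  | succ n ih =>
    simp only [partialSum_succ, place_succ, adicAdd, carry]
    linear_combination ih + place l n * Nat.mod_add_div ((x n : ℕ) + y n + carry x y n) (l n)

lemma residue_adicAdd (x y : AdicSeries l) (n : ℕ) :
    residue (adicAdd x y) n = residue x n + residue y n := by
  simpa [residue] using congrArg (Nat.cast : ℕ → ZMod (place l n)) (partialSum_adicAdd x y n)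

lemma residue_adicOne (hl : ∀ i, 2 ≤ l i) (n : ℕ) : residue (adicOne hl) n = 1 := by
  cases n with
  | zero => exact Subsingleton.elim (α := ZMod 1) _ _
  | succ n =>
    have hsum : partialSum (adicOne hl) (n + 1) = 1 := by simp [partialSum, adicOne, place]
    rw [residue, hsum, Nat.cast_one]

/-- The formal series `-1`, all of whose digits are maximal. -/
def adicNegOne (hl : ∀ i, 2 ≤ l i) : AdicSeries l := fun i => ⟨l i - 1, by grind⟩

lemma residue_adicNegOne (hl : ∀ i, 2 ≤ l i) (n : ℕ) : residue (adicNegOne hl) n = -1 := by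
  have hsum : partialSum (adicNegOne hl) n + 1 = place l n := by
    induction n with
    | zero => simp [partialSum, place]
    | succ n ih =>
      have hdigit : (adicNegOne hl n : ℕ) + 1 = l n := Nat.sub_add_cancel (by grind)
      rw [partialSum_succ, place_succ]
      linear_combination ih + place l n * hdigit
  rw [eq_neg_iff_add_eq_zero, residue, ← Nat.cast_succ, Nat.succ_eq_add_one, hsum,
    ZMod.natCast_self]

lemma adicAdd_mem_cylinder_iff (x y z : AdicSeries l) (n : ℕ) :
    adicAdd x z ∈ cylinder (adicAdd y z) n ↔ x ∈ cylinder y n := by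
  rw [← residue_eq_iff, ← residue_eq_iff, residue_adicAdd, residue_adicAdd, add_left_inj]

lemma measurable_adicAdd (z : AdicSeries l) : Measurable fun x => adicAdd x z :=
  (continuous_of_mem_cylinder fun n x y => (adicAdd_mem_cylinder_iff x y z n).2).measurable

/-- The odometer `x ↦ x + 1` as a Borel automorphism of the formal series. -/
def odometer (hl : ∀ i, 2 ≤ l i) : AdicSeries l ≃ᵐ AdicSeries l where
  toFun x := adicAdd x (adicOne hl)
  invFun x := adicAdd x (adicNegOne hl)
  left_inv x := ext_residue fun n => by
    simp only [residue_adicAdd, residue_adicOne, residue_adicNegOne, add_neg_cancel_right]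
  right_inv x := ext_residue fun n => by
    simp only [residue_adicAdd, residue_adicOne, residue_adicNegOne, neg_add_cancel_right]
  measurable_toFun := measurable_adicAdd _
  measurable_invFun := measurable_adicAdd _

lemma residue_odometer (hl : ∀ i, 2 ≤ l i) (x : AdicSeries l) (n : ℕ) :
    residue (odometer hl x) n = residue x n + 1 :=
  (residue_adicAdd _ _ _).trans (by rw [residue_adicOne])

lemma measurable_residue (n : ℕ) : Measurable fun x : AdicSeries l => residue x n := by
  have hsum : Measurable fun x : AdicSeries l => partialSum x n :=
    Finset.measurable_sum _ fun i _ =>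
      (Measurable.of_discrete (f := fun d : Fin (l i) => (d : ℕ) * place l i)).comp
        (measurable_pi_apply i)
  exact Measurable.of_discrete.comp hsum

lemma uncountable_adicSeries (hl : ∀ i, 2 ≤ l i) : Uncountable (AdicSeries l) := by
  have : Uncountable (ℕ → Fin 2) := by
    rw [← Cardinal.aleph0_lt_mk_iff]
    simpa using Cardinal.cantor Cardinal.aleph0
  have hinj : Injective fun (x : ℕ → Fin 2) (i : ℕ) => Fin.castLE (hl i) (x i) := fun x y h =>
    funext fun i => Fin.castLE_injective (hl i) (congrFun h i)
  exact hinj.uncountable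

end AdicSeries

section Transversals

variable {X : Type*} [MeasurableSpace X] {T : X ≃ᵐ X}

lemma image_iterate_eq_preimage (T : X ≃ᵐ X) (n : ℕ) (A : Set X) :
    T^[n] '' A = T.symm^[n] ⁻¹' A :=
  congrFun (Set.image_eq_preimage_of_inverse (T.left_inv.iterate n) (T.right_inv.iterate n)) A

lemma measurableSet_image_iterate (T : X ≃ᵐ X) (n : ℕ) {A : Set X} (hA : MeasurableSet A) :
    MeasurableSet (T^[n] '' A) := by
  rw [image_iterate_eq_preimage]
  exact T.symm.measurable.iterate n hA

lemma not_isSmooth_of_measurePreserving (hT : IsAperiodic T) {μ : Measure X}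
    [IsProbabilityMeasure μ] (hμ : MeasurePreserving T μ μ) : ¬ IsSmooth T := by
  rintro ⟨A, hA, htrans⟩
  have hA₀ : μ A = 0 := by
    by_contra hA₀
    obtain ⟨x, hx, m, hm, hmx⟩ := hμ.conservative.exists_mem_iterate_mem hA.nullMeasurableSet hA₀
    have hcycle : Equiv.Perm.SameCycle T.toEquiv x (T^[m] x) :=
      ⟨m, by rw [zpow_natCast, Equiv.Perm.coe_pow]; rfl⟩
    exact hT x ⟨m, Nat.pos_of_ne_zero hm,
      (htrans x).unique ⟨hmx, hcycle⟩ ⟨hx, Equiv.Perm.SameCycle.refl _ _⟩⟩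
  have htranslate : ∀ i : ℤ, μ ((T.toEquiv ^ i : Equiv.Perm X) ⁻¹' A) = 0 := by
    intro i
    obtain ⟨n, rfl | rfl⟩ := i.eq_nat_or_neg
    · rw [zpow_natCast, Equiv.Perm.coe_pow]
      exact ((hμ.iterate n).measure_preimage hA.nullMeasurableSet).trans hA₀
    · rw [zpow_neg, zpow_natCast, ← inv_pow, Equiv.Perm.coe_pow]
      exact (((hμ.symm T).iterate n).measure_preimage hA.nullMeasurableSet).trans hA₀
  have hcover : (Set.univ : Set X) ⊆ ⋃ i : ℤ, (T.toEquiv ^ i : Equiv.Perm X) ⁻¹' A := fun x _ =>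
    have ⟨y, ⟨hy, i, hi⟩, _⟩ := htrans x
    Set.mem_iUnion.2 ⟨i, by rwa [Set.mem_preimage, hi]⟩
  simpa using measure_mono_null hcover (measure_iUnion_null htranslate)

end Transversals

section RotationFactors

variable {X : Type*} [m : MeasurableSpace X] {T : X ≃ᵐ X} {h : ℕ} {φ : X → ZMod h}

/-- `φ` is a Borel factor map from `T` onto the rotation `j ↦ j + 1` of `ℤ / h`. -/
structure IsRotationFactor (T : X ≃ᵐ X) (φ : X → ZMod h) : Prop where
  measurable : Measurable φ
  semiconj : Semiconj φ T (· + 1)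

namespace IsRotationFactor

lemma apply_iterate (hφ : IsRotationFactor T φ) (k : ℕ) (x : X) : φ (T^[k] x) = φ x + k := by
  rw [(hφ.semiconj.iterate_right k).eq, add_right_iterate, nsmul_one]

lemma image_iterate_fiber (hφ : IsRotationFactor T φ) (k : ℕ) (j : ZMod h) :
    T^[k] '' (φ ⁻¹' {j}) = φ ⁻¹' {j + k} := by
  rw [image_iterate_eq_preimage]
  ext x
  have hx : T^[k] (T.symm^[k] x) = x := T.right_inv.iterate k x
  change φ (T.symm^[k] x) = j ↔ φ x = j + k
  rw [← add_left_inj (k : ZMod h), ← hφ.apply_iterate, hx]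

lemma measurableSet_fiber (hφ : IsRotationFactor T φ) (j : ZMod h) : MeasurableSet (φ ⁻¹' {j}) :=
  hφ.measurable (measurableSet_singleton j)

lemma not_countable_fiber_zero [Uncountable X] [NeZero h] (hφ : IsRotationFactor T φ) :
    ¬ (φ ⁻¹' {0}).Countable := fun hc => by
  have hcover : Set.univ ⊆ ⋃ k : ℕ, T^[k] '' (φ ⁻¹' {0}) := fun x _ =>
    Set.mem_iUnion.2 ⟨(φ x).val, by simp [hφ.image_iterate_fiber]⟩
  exact Set.not_countable_univ ((Set.countable_iUnion fun k => hc.image T^[k]).mono hcover)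

lemma castHom {h' : ℕ} (hφ : IsRotationFactor T φ) (hdvd : h' ∣ h) :
    IsRotationFactor T (ZMod.castHom hdvd (ZMod h') ∘ φ) where
  measurable := Measurable.of_discrete.comp hφ.measurable
  semiconj x := by simp only [comp_apply, hφ.semiconj.eq, map_add, map_one]

end IsRotationFactor

lemma isAperiodic_of_isRotationFactor {h : ℕ → ℕ} (hh : ∀ k, k < h k) {φ : ∀ n, X → ZMod (h n)}
    (hφ : ∀ n, IsRotationFactor T (φ n)) : IsAperiodic T := by
  rintro x ⟨k, hk, hx⟩
  have hcast : ((k : ℕ) : ZMod (h k)) = 0 := by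
    simpa [hx.eq] using (hφ k).apply_iterate k x
  exact (hh k).not_ge (Nat.le_of_dvd hk ((ZMod.natCast_eq_zero_iff k (h k)).1 hcast))

/-- The tower of height `h` whose levels are the fibers of a factor map onto a rotation of
`ℤ / h`. -/
def Multitower.ofRotation [Uncountable X] [NeZero h] (hφ : IsRotationFactor T φ) :
    Multitower T where
  J := Unit
  countable_J := inferInstance
  base _ := φ ⁻¹' {0}
  top _ := h - 1
  measurable_base _ := hφ.measurableSet_fiber 0
  uncountable_base _ := hφ.not_countable_fiber_zero
  disjoint_levels _ i _ i' hi hi' hne := by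
    rw [hφ.image_iterate_fiber, hφ.image_iterate_fiber, zero_add, zero_add]
    refine Disjoint.preimage φ (Set.disjoint_singleton.2 fun heq => ?_)
    have hpos := NeZero.pos h
    exact hne.elim (· rfl) (· (((ZMod.natCast_eq_natCast_iff _ _ _).1 heq).eq_of_lt_of_lt
      (by omega) (by omega)))

namespace Multitower

variable [Uncountable X] [NeZero h]

lemma rank_ofRotation (hφ : IsRotationFactor T φ) : (ofRotation hφ).rank = 1 := by
  simp [rank, ofRotation]

lemma atoms_ofRotation (hφ : IsRotationFactor T φ) :
    (ofRotation hφ).atoms = Set.range fun j => φ ⁻¹' {j} := by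
  ext A
  constructor
  · rintro ⟨⟨⟩, i, -, rfl⟩
    exact ⟨0 + i, (hφ.image_iterate_fiber i 0).symm⟩
  · rintro ⟨j, rfl⟩
    refine ⟨(), j.val, Nat.le_sub_one_of_lt j.val_lt, ?_⟩
    simp [ofRotation, hφ.image_iterate_fiber]

lemma support_ofRotation (hφ : IsRotationFactor T φ) : (ofRotation hφ).support = Set.univ := by
  rw [support, atoms_ofRotation, Set.sUnion_range, ← Set.preimage_iUnion,
    Set.iUnion_of_singleton, Set.preimage_univ]

lemma refines_ofRotation {h' : ℕ} [NeZero h'] {φ' : X → ZMod h'} (hφ : IsRotationFactor T φ)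
    (hφ' : IsRotationFactor T φ') (hle : ∀ x y, φ' x = φ' y → φ x = φ y) :
    (ofRotation hφ').Refines (ofRotation hφ) := by
  simp only [Refines, atoms_ofRotation, Set.forall_mem_range]
  refine fun j => ⟨(fun x => φ' ⁻¹' {φ' x}) '' (φ ⁻¹' {j}),
    Set.image_subset_iff.2 fun x _ => ⟨φ' x, rfl⟩, ?_⟩
  ext x
  simp only [Set.sUnion_image, Set.mem_iUnion]
  exact ⟨fun hx => ⟨x, hx, rfl⟩, fun ⟨y, hy, hxy⟩ => (hle x y hxy).trans hy⟩

end Multitower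

lemma hasRankAtMost_one_of_isRotationFactor [Uncountable X]
    (hT : IsAperiodic T) (hsmooth : ¬ IsSmooth T) {h : ℕ → ℕ} [∀ n, NeZero (h n)]
    {φ : ∀ n, X → ZMod (h n)} (hφ : ∀ n, IsRotationFactor T (φ n))
    (hrefine : ∀ n x y, φ (n + 1) x = φ (n + 1) y → φ n x = φ n y)
    (hgen : MeasurableSpace.generateFrom (⋃ n, Set.range fun j => φ n ⁻¹' {j}) = m) :
    HasRankAtMost T 1 := by
  refine ⟨hT, hsmooth, fun n => .ofRotation (hφ n), fun n => ?_, fun n => ?_, ?_, ?_⟩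
  · rw [Multitower.rank_ofRotation, Nat.cast_one]
  · exact Multitower.refines_ofRotation _ _ (hrefine n)
  · simp only [Multitower.support_ofRotation, Set.iUnion_const]
  · simpa only [Multitower.atoms_ofRotation] using hgen

end RotationFactors

section Odometers

variable {X : Type*} [m : MeasurableSpace X] {S : X ≃ᵐ X} {l : ℕ → ℕ} {hl : ∀ i, 2 ≤ l i}
  {e : X ≃ᵐ AdicSeries l}

lemma isRotationFactor_residue (he : Semiconj e S (odometer hl)) (n : ℕ) :
    IsRotationFactor S fun x => residue (e x) n where
  measurable := (measurable_residue n).comp e.measurable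
  semiconj x := (congrArg (residue · n) (he x)).trans (residue_odometer hl (e x) n)

lemma isAperiodic_of_semiconj_odometer (he : Semiconj e S (odometer hl)) : IsAperiodic S :=
  isAperiodic_of_isRotationFactor
    (fun k => k.lt_two_pow_self.trans_le (two_pow_le_place hl k)) (isRotationFactor_residue he)

lemma measurePreserving_odometer (hl : ∀ i, 2 ≤ l i) :
    MeasurePreserving (odometer hl)
      (Measure.infinitePi fun i => uniformOn (Set.univ : Set (Fin (l i))))
      (Measure.infinitePi fun i => uniformOn (Set.univ : Set (Fin (l i)))) := by
  have : ∀ i, NeZero (l i) := fun i => ⟨by grind⟩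
  exact measurePreserving_of_mem_cylinder_iff _ fun n x y => adicAdd_mem_cylinder_iff x y _ n

lemma not_isSmooth_of_semiconj_odometer (he : Semiconj e S (odometer hl)) : ¬ IsSmooth S := by
  have : ∀ i, NeZero (l i) := fun i => ⟨by grind⟩
  let μ : Measure (AdicSeries l) := Measure.infinitePi fun i => uniformOn Set.univ
  have hsymm : MeasurePreserving e.symm μ (μ.map e.symm) :=
    e.symm.measurable.measurePreserving μ
  have : IsProbabilityMeasure (μ.map e.symm) :=
    Measure.isProbabilityMeasure_map e.symm.measurable.aemeasurable
  exact not_isSmooth_of_measurePreserving (isAperiodic_of_semiconj_odometer he)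
    (hsymm.of_semiconj (measurePreserving_odometer hl)
      (he.inverse_left e.left_inv e.right_inv) S.measurable)

lemma generateFrom_residue_fibers (e : X ≃ᵐ AdicSeries l) :
    MeasurableSpace.generateFrom
      (⋃ n, Set.range fun j : ZMod (place l n) => (fun x => residue (e x) n) ⁻¹' {j}) = m := by
  refine le_antisymm (MeasurableSpace.generateFrom_le fun A hA => ?_) ?_
  · obtain ⟨n, j, rfl⟩ := Set.mem_iUnion.1 hA
    exact (measurable_residue n).comp e.measurable (measurableSet_singleton j)
  · refine e.measurableEmbedding.comap_eq.ge.trans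
      ((MeasurableSpace.comap_mono generateFrom_cylinders.le).trans ?_)
    rw [MeasurableSpace.comap_generateFrom]
    refine MeasurableSpace.generateFrom_mono ?_
    rintro _ ⟨_, ⟨y, n, rfl⟩, rfl⟩
    exact Set.mem_iUnion.2 ⟨n, residue y n, Set.ext fun x => residue_eq_iff⟩

lemma hasRankAtMost_one_of_semiconj_odometer (he : Semiconj e S (odometer hl)) :
    HasRankAtMost S 1 := by
  have := uncountable_adicSeries hl
  have : Uncountable X := e.symm.injective.uncountable
  have : ∀ n, NeZero (place l n) := fun n =>
    ⟨((Nat.two_pow_pos n).trans_le (two_pow_le_place hl n)).ne'⟩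
  refine hasRankAtMost_one_of_isRotationFactor (isAperiodic_of_semiconj_odometer he)
    (not_isSmooth_of_semiconj_odometer he) (isRotationFactor_residue he) (fun n x y hxy => ?_)
    (generateFrom_residue_fibers e)
  exact residue_eq_iff.2 (cylinder_anti _ n.le_succ (residue_eq_iff.1 hxy))

lemma nonempty_of_hasRankAtMost {T : X ≃ᵐ X} {r : ℕ} (h : HasRankAtMost T r) : Nonempty X := by
  by_contra hX
  rw [not_nonempty_iff] at hX
  exact h.2.1 ⟨∅, MeasurableSet.empty, fun x => isEmptyElim x⟩

lemma not_hasRankAtMost_zero (T : X ≃ᵐ X) : ¬ HasRankAtMost T 0 := by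
  intro h
  obtain ⟨x⟩ := nonempty_of_hasRankAtMost h
  obtain ⟨-, -, η, hr, -, hs, -⟩ := h
  obtain ⟨n, A, ⟨j, -⟩, -⟩ := Set.mem_iUnion.1 (hs.symm.subset (Set.mem_univ x))
  have hn := hr n
  rw [Multitower.rank, Nat.cast_zero, nonpos_iff_eq_zero, ENat.card_eq_zero_iff_empty] at hn
  exact hn.false j

lemma odometers_subset_rankSet_one (X : Type*) [MeasurableSpace X] :
    odometers X ⊆ rankSet X 1 := by
  rintro S ⟨l, hl, e, he⟩
  refine ⟨hasRankAtMost_one_of_semiconj_odometer (hl := hl) he, fun s hs => ?_⟩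
  rw [Nat.lt_one_iff.1 hs]
  exact not_hasRankAtMost_zero S

end Odometers

section StandardBorel

variable {X Y : Type*} [MeasurableSpace X] [StandardBorelSpace X] [MeasurableSpace Y]
  [StandardBorelSpace Y]

/-- A measurable bijection between standard Borel spaces, as an isomorphism. -/
noncomputable def measurableEquivOfBijective (f : Y → X) (hf : Measurable f)
    (hb : Bijective f) : Y ≃ᵐ X where
  toEquiv := Equiv.ofBijective f hb
  measurable_toFun := hf
  measurable_invFun s hs := by
    rw [← Equiv.image_eq_preimage_symm]
    exact (hf.measurableEmbedding hb.injective).measurableSet_image.2 hs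

lemma exists_measurableEquiv_eqOn {s : Set Y} (hs : MeasurableSet s) {g : Y → X}
    (hg : Measurable g) (hinj : Set.InjOn g s) (hsc : ¬ sᶜ.Countable)
    (himg : ¬ (g '' s)ᶜ.Countable) : ∃ Φ : Y ≃ᵐ X, Set.EqOn Φ g s := by
  classical
  have himage : MeasurableSet (g '' s) := hs.image_of_measurable_injOn hg hinj
  have := hs.standardBorel
  have := hs.compl.standardBorel
  have := himage.standardBorel
  have := himage.compl.standardBorel
  let c : ↥sᶜ ≃ᵐ ↥(g '' s)ᶜ := PolishSpace.measurableEquivOfNotCountable hsc himg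
  let f : s ≃ᵐ g '' s := measurableEquivOfBijective (s.imageFactorization g)
    (hg.comp measurable_subtype_coe).subtype_mk
    ⟨Set.imageFactorization_injective_iff.2 hinj, Set.imageFactorization_surjective⟩
  refine ⟨(MeasurableEquiv.sumCompl hs).symm.trans ((f.sumCongr c).trans
    (MeasurableEquiv.sumCompl himage)), fun y hy => ?_⟩
  have hsymm : (MeasurableEquiv.sumCompl hs).symm y = Sum.inl ⟨y, hy⟩ :=
    Equiv.Set.sumCompl_symm_apply_of_mem hy
  rw [MeasurableEquiv.trans_apply, hsymm]
  rfl

lemma exists_measurableEquiv_pair [Uncountable Y] [Uncountable X] {a b : Y} (hab : a ≠ b)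
    {c d : X} (hcd : c ≠ d) : ∃ κ : Y ≃ᵐ X, κ a = c ∧ κ b = d := by
  classical
  let g : Y → X := fun y => if y = a then c else d
  have hga : g a = c := if_pos rfl
  have hgb : g b = d := if_neg hab.symm
  have hpair : ({a, b} : Set Y).Countable := Set.to_countable _
  obtain ⟨κ, hκ⟩ := exists_measurableEquiv_eqOn (g := g) hpair.measurableSet
    (Measurable.ite (measurableSet_singleton a) measurable_const measurable_const)
    (Set.injOn_pair.2 fun h => absurd (hga.symm.trans (h.trans hgb)) hcd)
    (fun h => Set.not_countable_univ (Set.union_compl_self {a, b} ▸ hpair.union h))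
    (fun h => Set.not_countable_univ (Set.union_compl_self (g '' {a, b}) ▸ (hpair.image g).union h))
  exact ⟨κ, (hκ (by simp)).trans hga, (hκ (by simp)).trans hgb⟩

lemma exists_uncountable_subset_measure_lt {B : Set X} (hB : MeasurableSet B)
    (hB' : ¬ B.Countable) (ν : Measure X) [IsFiniteMeasure ν] {ε : ENNReal} (hε : ε ≠ 0) :
    ∃ A ⊆ B, MeasurableSet A ∧ ¬ A.Countable ∧ ν A < ε := by
  have := hB.standardBorel
  have hprod : Uncountable (ℕ × ℝ) := (Prod.mk_right_injective 0).uncountable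
  let e : ℕ × ℝ ≃ᵐ B := PolishSpace.measurableEquivOfNotCountable not_countable hB'
  let f : ℕ → ℝ → X := fun n r => e (n, r)
  have hinj : ∀ n, Injective (f n) := fun n =>
    Subtype.val_injective.comp (e.injective.comp (Prod.mk_right_injective n))
  have hmeas : ∀ n, MeasurableSet (Set.range (f n)) := fun n =>
    ((measurable_subtype_coe.comp (e.measurable.comp measurable_prodMk_left)).measurableEmbedding
      (hinj n)).measurableSet_range
  have hdisj : Pairwise (Disjoint on fun n => Set.range (f n)) := fun i j hij =>
    Set.disjoint_range_iff.2 fun r s hrs =>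
      hij (congrArg Prod.fst (e.injective (Subtype.val_injective hrs)))
  have hsum : ∑' n, ν (Set.range (f n)) ≠ ⊤ :=
    measure_iUnion hdisj hmeas ▸ measure_ne_top _ _
  obtain ⟨n, hn⟩ := ((ENNReal.tendsto_atTop_zero_of_tsum_ne_top hsum).eventually_lt_const
    (pos_iff_ne_zero.2 hε)).exists
  exact ⟨Set.range (f n), Set.range_subset_iff.2 fun r => (e (n, r)).2, hmeas n,
    fun hc => Set.not_countable_univ (Set.countable_of_injective_of_countable_image
      (hinj n).injOn (Set.image_univ ▸ hc)), hn⟩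

end StandardBorel

section Towers

variable {X Z : Type*} [MeasurableSpace X] [MeasurableSpace Z] {T : X ≃ᵐ X} {O : Z ≃ᵐ Z}
  {A B : Set X} {m : ℕ}

/-- `(B, T B, …, T ^ m B)` is a `T`-tower. -/
structure IsTower (T : X ≃ᵐ X) (B : Set X) (m : ℕ) : Prop where
  measurableSet : MeasurableSet B
  not_countable : ¬ B.Countable
  pairwiseDisjoint : (Set.Iic m).PairwiseDisjoint fun i => T^[i] '' B

/-- The coordinates `(y, i) ↦ T ^ i y` on the levels `B, T B, …, T ^ m B`. -/
def towerMap (T : X ≃ᵐ X) (B : Set X) (m : ℕ) (p : B × Fin (m + 1)) : X := T^[p.2] p.1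

lemma measurable_towerMap (T : X ≃ᵐ X) (B : Set X) (m : ℕ) : Measurable (towerMap T B m) :=
  measurable_from_prod_countable_left fun i =>
    (T.measurable.iterate (i : ℕ)).comp measurable_subtype_coe

lemma IsTower.injective_towerMap (hB : IsTower T B m) : Injective (towerMap T B m) := by
  rintro ⟨x, i⟩ ⟨y, j⟩ (hxy : T^[i] x = T^[j] y)
  obtain rfl : i = j := Fin.ext (hB.pairwiseDisjoint.elim_set (Nat.lt_succ_iff.1 i.isLt)
    (Nat.lt_succ_iff.1 j.isLt) _ ⟨x, x.2, rfl⟩ ⟨y, y.2, hxy.symm⟩)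
  rw [Subtype.ext (T.injective.iterate i hxy)]

/-- The uncountable set `A` makes room: removing its `T`-orbit segments from the tower leaves
uncountably many coordinates free to be mapped onto the complement of the rest of the tower. -/
lemma IsTower.exists_measurableEquiv [StandardBorelSpace X] (hB : IsTower T B m) (hAB : A ⊆ B)
    (hA : MeasurableSet A) (hA' : ¬ A.Countable) :
    ∃ Φ : B × Fin (m + 1) ≃ᵐ X, ∀ y : B, (y : X) ∉ A → ∀ i, Φ (y, i) = T^[i] y := by
  have := hB.measurableSet.standardBorel
  let s : Set (B × Fin (m + 1)) := {p | (p.1 : X) ∉ A}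
  have hs : MeasurableSet s := (measurable_subtype_coe.comp measurable_fst) hA.compl
  have hbase : A ⊆ towerMap T B m '' sᶜ := fun x hx => ⟨(⟨x, hAB hx⟩, 0), not_not.2 hx, rfl⟩
  have hsc : ¬ (towerMap T B m '' sᶜ).Countable := fun h => hA' (h.mono hbase)
  obtain ⟨Φ, hΦ⟩ := exists_measurableEquiv_eqOn hs (measurable_towerMap T B m)
    hB.injective_towerMap.injOn (fun h => hsc (h.image _))
    (fun h => hsc (h.mono (Set.image_compl_subset hB.injective_towerMap)))
  exact ⟨Φ, fun y hy i => hΦ hy⟩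

namespace IsRotationFactor

variable [Uncountable Z] {φ : Z → ZMod (m + 1)}

lemma isTower (hφ : IsRotationFactor O φ) : IsTower O (φ ⁻¹' {0}) m where
  measurableSet := hφ.measurableSet_fiber 0
  not_countable := hφ.not_countable_fiber_zero
  pairwiseDisjoint i hi j hj hij :=
    (Multitower.ofRotation hφ).disjoint_levels () i () j hi hj (.inr hij)

lemma bijective_towerMap (hφ : IsRotationFactor O φ) :
    Bijective (towerMap O (φ ⁻¹' {0}) m) := by
  refine ⟨hφ.isTower.injective_towerMap, fun z => ?_⟩
  have hz : z ∈ O^[(φ z).val] '' (φ ⁻¹' {0}) := by simp [hφ.image_iterate_fiber]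
  obtain ⟨y, hy, hyz⟩ := hz
  exact ⟨(⟨y, hy⟩, ⟨(φ z).val, (φ z).val_lt⟩), hyz⟩

end IsRotationFactor

lemma IsTower.exists_conj_of_isRotationFactor [StandardBorelSpace X] [StandardBorelSpace Z]
    [Uncountable Z] (hB : IsTower T B m) (hAB : A ⊆ B) (hA : MeasurableSet A)
    (hA' : ¬ A.Countable) {a b : X} (ha : a ∈ B \ A) (hb : b ∈ B \ A) (hab : a ≠ b)
    (hO : IsAperiodic O) {φ : Z → ZMod (m + 1)} (hφ : IsRotationFactor O φ) :
    ∃ e : X ≃ᵐ Z, (∀ x ∈ B \ A, ∀ i ≤ m, e (T^[i] x) = O^[i] (e x)) ∧ e b = O^[m + 1] (e a) := by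
  have := hB.measurableSet.standardBorel
  have := hφ.isTower.measurableSet.standardBorel
  have : Uncountable B := not_countable_iff.1 hB.not_countable
  have : Uncountable (φ ⁻¹' {0}) := not_countable_iff.1 hφ.not_countable_fiber_zero
  obtain ⟨z⟩ : Nonempty (φ ⁻¹' {0}) := inferInstance
  have hz : φ (O^[m + 1] z) = 0 := by
    rw [hφ.apply_iterate, ZMod.natCast_self, add_zero]
    exact z.2
  have hne : z ≠ ⟨O^[m + 1] z, hz⟩ := fun h =>
    hO z ⟨m + 1, m.succ_pos, (congrArg Subtype.val h).symm⟩
  obtain ⟨Φ, hΦ⟩ := hB.exists_measurableEquiv hAB hA hA'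
  obtain ⟨κ, hκa, hκb⟩ :=
    exists_measurableEquiv_pair (a := (⟨a, ha.1⟩ : B)) (b := ⟨b, hb.1⟩) (by simpa using hab) hne
  let e : X ≃ᵐ Z := Φ.symm.trans ((κ.prodCongr (.refl _)).trans
    (measurableEquivOfBijective _ (measurable_towerMap O _ m) hφ.bijective_towerMap))
  have he : ∀ y (hy : y ∈ B \ A) (i : Fin (m + 1)), e (T^[i] y) = O^[i] (κ ⟨y, hy.1⟩) := by
    intro y hy i
    have hsymm : Φ.symm (T^[i] y) = (⟨y, hy.1⟩, i) := Φ.symm_apply_eq.2 (hΦ ⟨y, hy.1⟩ hy.2 i).symm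
    rw [MeasurableEquiv.trans_apply, hsymm]
    rfl
  have he₀ : ∀ y (hy : y ∈ B \ A), e y = κ ⟨y, hy.1⟩ := fun y hy => he y hy 0
  refine ⟨e, fun x hx i hi => ?_, ?_⟩
  · rw [he₀ x hx]
    exact he x hx ⟨i, Nat.lt_succ_iff.2 hi⟩
  · rw [he₀ b hb, he₀ a ha, hκa, hκb]

lemma IsTower.exists_odometer [StandardBorelSpace X] (hB : IsTower T B m) (hAB : A ⊆ B)
    (hA : MeasurableSet A) (hA' : ¬ A.Countable) {a b : X} (ha : a ∈ B \ A) (hb : b ∈ B \ A)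
    (hab : a ≠ b) :
    ∃ S ∈ odometers X, (∀ x ∈ B \ A, ∀ i < m, S (T^[i] x) = T (T^[i] x)) ∧ S (T^[m] a) = b := by
  let l : ℕ → ℕ := fun _ => 2 * (m + 1)
  have hl : ∀ i, 2 ≤ l i := fun _ => by grind
  have := uncountable_adicSeries hl
  have hdvd : m + 1 ∣ place l 1 := by simp [place, l]
  have hid : Semiconj (MeasurableEquiv.refl (AdicSeries l)) (odometer hl) (odometer hl) :=
    Semiconj.id_left
  obtain ⟨e, he, heab⟩ := hB.exists_conj_of_isRotationFactor hAB hA hA' ha hb hab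
    (isAperiodic_of_semiconj_odometer hid) ((isRotationFactor_residue hid 1).castHom hdvd)
  let S : X ≃ᵐ X := e.trans ((odometer hl).trans e.symm)
  have hS : ∀ x, e (S x) = odometer hl (e x) := fun x => e.apply_symm_apply _
  refine ⟨S, ⟨l, hl, e, hS⟩, fun x hx i hi => e.injective ?_, e.injective ?_⟩
  · rw [hS, ← iterate_succ_apply' T, he x hx i hi.le, he x hx (i + 1) hi, iterate_succ_apply']
  · rw [hS, he a ha m le_rfl, heab, iterate_succ_apply']

end Towers

section Refinement

variable {X : Type*} [m : MeasurableSpace X] {T : X ≃ᵐ X}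

namespace Multitower

variable {η η' η'' : Multitower T}

lemma pairwiseDisjoint_atoms (η : Multitower T) : η.atoms.PairwiseDisjoint id := by
  rintro _ ⟨j, i, hi, rfl⟩ _ ⟨j', i', hi', rfl⟩ hne
  refine η.disjoint_levels j i j' i' hi hi' (not_and_or.1 ?_)
  rintro ⟨rfl, rfl⟩
  exact hne rfl

lemma refines_iff :
    η'.Refines η ↔ ∀ A ∈ η.atoms, ∀ x ∈ A, ∃ C ∈ η'.atoms, x ∈ C ∧ C ⊆ A := by
  refine forall₂_congr fun A _ => ⟨?_, fun h => ?_⟩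
  · rintro ⟨𝒞, h𝒞, rfl⟩ x ⟨C, hC, hxC⟩
    exact ⟨C, h𝒞 hC, hxC, Set.subset_sUnion_of_mem hC⟩
  · refine ⟨{C ∈ η'.atoms | C ⊆ A}, Set.sep_subset _ _, Set.Subset.antisymm (fun x hx => ?_)
      (Set.sUnion_subset fun C hC => hC.2)⟩
    obtain ⟨C, hC, hxC, hCA⟩ := h x hx
    exact ⟨C, ⟨hC, hCA⟩, hxC⟩

namespace Refines

lemma refl (η : Multitower T) : η.Refines η :=
  refines_iff.2 fun A hA _ hx => ⟨A, hA, hx, Set.Subset.rfl⟩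

lemma trans (h : η''.Refines η') (h' : η'.Refines η) : η''.Refines η :=
  refines_iff.2 fun A hA x hx =>
    have ⟨_, hC, hxC, hCA⟩ := refines_iff.1 h' A hA x hx
    have ⟨D, hD, hxD, hDC⟩ := refines_iff.1 h _ hC x hxC
    ⟨D, hD, hxD, hDC.trans hCA⟩

lemma of_le {η : ℕ → Multitower T} (h : ∀ n, (η (n + 1)).Refines (η n)) {k n : ℕ} (hkn : k ≤ n) :
    (η n).Refines (η k) := by
  induction n, hkn using Nat.le_induction with
  | base => exact .refl _
  | succ n _ ih => exact (h n).trans ih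

lemma subset_of_mem (h : η'.Refines η) {A C : Set X} (hA : A ∈ η.atoms) (hC : C ∈ η'.atoms) {x : X}
    (hxA : x ∈ A) (hxC : x ∈ C) : C ⊆ A := by
  obtain ⟨D, hD, hxD, hDA⟩ := refines_iff.1 h A hA x hxA
  rwa [η'.pairwiseDisjoint_atoms.elim_set hC hD x hxC hxD]

lemma support_subset (h : η'.Refines η) : η.support ⊆ η'.support := by
  rintro x ⟨A, hA, hx⟩
  obtain ⟨C, hC, hxC, -⟩ := refines_iff.1 h A hA x hx
  exact ⟨C, hC, hxC⟩

end Refines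

lemma eventually_mem_support {η : ℕ → Multitower T} (href : ∀ n, (η (n + 1)).Refines (η n))
    (hcover : ⋃ n, (η n).support = Set.univ) (x : X) : ∀ᶠ n in atTop, x ∈ (η n).support :=
  have ⟨k, hk⟩ := Set.mem_iUnion.1 (hcover.symm.subset (Set.mem_univ x))
  (eventually_ge_atTop k).mono fun _ hn => (Refines.of_le href hn).support_subset hk

lemma eq_of_frequently_mem_atom [MeasurableSingletonClass X] {η : ℕ → Multitower T}
    (href : ∀ n, (η (n + 1)).Refines (η n))
    (hgen : MeasurableSpace.generateFrom (⋃ n, (η n).atoms) = m) {x y : X}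
    (h : ∃ᶠ n in atTop, ∃ A ∈ (η n).atoms, x ∈ A ∧ y ∈ A) : x = y := by
  have hmem : ∀ A ∈ ⋃ n, (η n).atoms, x ∈ A ↔ y ∈ A := by
    intro A hA
    obtain ⟨k, hk⟩ := Set.mem_iUnion.1 hA
    obtain ⟨n, ⟨C, hC, hxC, hyC⟩, hkn⟩ := (h.and_eventually (eventually_ge_atTop k)).exists
    have hrefine := Refines.of_le href hkn
    exact ⟨fun hx => hrefine.subset_of_mem hk hC hx hxC hyC,
      fun hy => hrefine.subset_of_mem hk hC hy hyC hxC⟩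
  have : MeasurableSpace.SeparatesPoints X := inferInstance
  rw [← hgen] at this
  exact MeasurableSpace.separating_of_generateFrom _ x y hmem

lemma isTower (η : Multitower T) (j : η.J) : IsTower T (η.base j) (η.top j) where
  measurableSet := η.measurable_base j
  not_countable := η.uncountable_base j
  pairwiseDisjoint i hi i' hi' hne := η.disjoint_levels j i j i' hi hi' (.inr hne)

end Multitower

/-- The union of the levels `B, T B, …, T ^ m B`. -/
def towerSupport (T : X ≃ᵐ X) (B : Set X) (m : ℕ) : Set X := ⋃ i ≤ m, T^[i] '' B

lemma measurableSet_towerSupport (T : X ≃ᵐ X) {B : Set X} (hB : MeasurableSet B) (m : ℕ) :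
    MeasurableSet (towerSupport T B m) :=
  .iUnion fun i => .iUnion fun _ => measurableSet_image_iterate T i hB

lemma Multitower.support_eq_towerSupport (η : Multitower T) [Subsingleton η.J] (j : η.J) :
    η.support = towerSupport T (η.base j) (η.top j) := by
  ext x
  simp only [support, atoms, towerSupport, Set.mem_sUnion, Set.mem_iUnion, Set.mem_ofPred_eq]
  constructor
  · rintro ⟨_, ⟨j', i, hi, rfl⟩, hx⟩
    obtain rfl := Subsingleton.elim j j'
    exact ⟨i, hi, hx⟩
  · rintro ⟨i, hi, hx⟩
    exact ⟨_, ⟨j, i, hi, rfl⟩, hx⟩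

/-- A sequence of `T`-towers that eventually contain each given point and eventually separate any
two given points. -/
structure IsExhaustingTowers (T : X ≃ᵐ X) (B : ℕ → Set X) (m : ℕ → ℕ) : Prop where
  isTower : ∀ n, IsTower T (B n) (m n)
  eventually_mem : ∀ x, ∀ᶠ n in atTop, x ∈ towerSupport T (B n) (m n)
  separates : ∀ x y,
    (∃ᶠ n in atTop, ∃ i ≤ m n, x ∈ T^[i] '' B n ∧ y ∈ T^[i] '' B n) → x = y

lemma HasRankAtMost.exists_isExhaustingTowers [MeasurableSingletonClass X]
    (h : HasRankAtMost T 1) : ∃ B m, IsExhaustingTowers T B m := by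
  obtain ⟨x₀⟩ := nonempty_of_hasRankAtMost h
  obtain ⟨-, -, η, hrank, href, hcover, hgen⟩ := h
  have hmem := Multitower.eventually_mem_support href hcover
  obtain ⟨N, hN⟩ := eventually_atTop.1 (hmem x₀)
  have hshift : Tendsto (· + N) atTop atTop := tendsto_add_atTop_nat N
  have hsub : ∀ n, Subsingleton (η n).J := fun n =>
    (ENat.card_le_one_iff_subsingleton _).1 (mod_cast hrank n)
  have hne : ∀ n, Nonempty (η (n + N)).J := fun n =>
    have ⟨_, ⟨j, _⟩, _⟩ := hN (n + N) (Nat.le_add_left N n)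
    ⟨j⟩
  let j := fun n => (hne n).some
  refine ⟨fun n => (η (n + N)).base (j n), fun n => (η (n + N)).top (j n),
    fun n => (η (n + N)).isTower (j n), fun x => ?_, fun x y hxy => ?_⟩
  · filter_upwards [hshift.eventually (hmem x)] with n hn
    rwa [← Multitower.support_eq_towerSupport]
  · refine Multitower.eq_of_frequently_mem_atom href hgen (hshift.frequently (hxy.mono ?_))
    rintro n ⟨i, hi, hx, hy⟩
    exact ⟨_, ⟨j n, i, hi, rfl⟩, hx, hy⟩

lemma IsTower.map_mem_base {B : Set X} {m : ℕ} (h : IsTower T B m) {x : X} (hx : x ∈ T^[m] '' B)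
    (hTx : T x ∈ towerSupport T B m) : T x ∈ B := by
  obtain ⟨i, hi, y, hy, hyx⟩ := Set.mem_iUnion₂.1 hTx
  cases i with
  | zero => exact hyx ▸ hy
  | succ i =>
    have hxy : T^[i] y = x := T.injective ((iterate_succ_apply' T i y).symm.trans hyx)
    have hdisj := h.pairwiseDisjoint (Nat.le_of_succ_le hi) Set.self_mem_Iic (Nat.ne_of_lt hi)
    exact absurd hx (Set.disjoint_left.1 hdisj ⟨y, hy, hxy⟩)

/-- The set of points where an automorphism that agrees with `T` below the top of the tower and maps
`T^[m] a` to `b` may differ from `T`: the complement of the tower, and its top, except for `T^[m] a`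
if `T` maps this point to `b`. -/
def towerError (T : X ≃ᵐ X) (B : Set X) (m : ℕ) (a b : X) : Set X :=
  (towerSupport T B m)ᶜ ∪ T^[m] '' B \ ({T^[m] a} ∩ T ⁻¹' {b})

lemma measurableSet_towerError [MeasurableSingletonClass X] (T : X ≃ᵐ X) {B : Set X}
    (hB : MeasurableSet B) (m : ℕ) (a b : X) : MeasurableSet (towerError T B m a b) :=
  (measurableSet_towerSupport T hB m).compl.union <| (measurableSet_image_iterate T m hB).diff <|
    (measurableSet_singleton _).inter (T.measurable (measurableSet_singleton b))

namespace IsExhaustingTowers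

variable {B : ℕ → Set X} {m : ℕ → ℕ}

-- Two points cannot both lie in infinitely many common tops. So if some `x` lies in infinitely many
-- tops, then along those towers every other point eventually leaves the tops, and `x` is the only
-- link that has to be preserved; otherwise any two base points will do.
lemma exists_links (h : IsExhaustingTowers T B m) (hT : IsAperiodic T) :
    ∃ (L : Filter ℕ) (a b : ℕ → X), L.NeBot ∧ L.IsCountablyGenerated ∧ L ≤ atTop ∧
      (∀ᶠ n in L, a n ∈ B n ∧ b n ∈ B n ∧ a n ≠ b n) ∧
      ∀ x, ∀ᶠ n in L, x ∈ T^[m n] '' B n → x = T^[m n] (a n) ∧ T x = b n := by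
  by_cases hx : ∃ x, ∃ᶠ n in atTop, x ∈ T^[m n] '' B n
  · obtain ⟨x, hx⟩ := hx
    have hiter : ∀ n, T^[m n] (T.symm^[m n] x) = x := fun n =>
      LeftInverse.iterate T.apply_symm_apply (m n) x
    refine ⟨atTop ⊓ 𝓟 {n | x ∈ T^[m n] '' B n}, fun n => T.symm^[m n] x, fun _ => T x,
      frequently_mem_iff_neBot.1 hx, inferInstance, inf_le_left, ?_, fun y => ?_⟩
    · rw [eventually_inf_principal]
      filter_upwards [h.eventually_mem (T x)] with n hTx hxn
      refine ⟨by rwa [image_iterate_eq_preimage] at hxn, (h.isTower n).map_mem_base hxn hTx,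
        fun heq => hT (T x) ⟨m n + 1, Nat.succ_pos _, ?_⟩⟩
      rw [IsPeriodicPt, IsFixedPt, iterate_succ_apply', ← heq, hiter, heq]
    · rw [eventually_inf_principal]
      obtain rfl | hyx := eq_or_ne y x
      · exact .of_forall fun n _ _ => ⟨(hiter n).symm, rfl⟩
      · filter_upwards [not_frequently.1 (mt (h.separates y x) hyx)] with n hn hxn hyn
        exact absurd ⟨m n, le_rfl, hyn, hxn⟩ hn
  · have hnontriv : ∀ n, (B n).Nontrivial := fun n =>
      Set.not_subsingleton_iff.1 fun hB => (h.isTower n).not_countable hB.countable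
    choose a ha b hb hab using hnontriv
    push Not at hx
    exact ⟨atTop, a, b, inferInstance, inferInstance, le_rfl,
      .of_forall fun n => ⟨ha n, hb n, hab n⟩, fun x => (hx x).mono fun n hn hxn => absurd hxn hn⟩

lemma exists_measure_towerError_lt [MeasurableSingletonClass X] (h : IsExhaustingTowers T B m)
    (hT : IsAperiodic T) (ν : Measure X) [IsFiniteMeasure ν] {ε : ENNReal} (hε : ε ≠ 0) :
    ∃ n, ∃ a ∈ B n, ∃ b ∈ B n, a ≠ b ∧ ν (towerError T (B n) (m n) a b) < ε := by
  obtain ⟨L, a, b, _, _, hL, hab, hlink⟩ := h.exists_links hT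
  have hnotMem : ∀ x, ∀ᶠ n in L, x ∉ towerError T (B n) (m n) (a n) (b n) := fun x => by
    filter_upwards [hL (h.eventually_mem x), hlink x] with n hx hxlink
    rintro (hx' | ⟨hx', hne⟩)
    · exact hx' hx
    · exact hne (hxlink hx')
  have htendsto : Tendsto (fun n => ν (towerError T (B n) (m n) (a n) (b n))) L (𝓝 (ν ∅)) :=
    tendsto_measure_of_tendsto_indicator_of_isFiniteMeasure L ν
      (fun n => measurableSet_towerError T (h.isTower n).measurableSet _ _ _)
      fun x => (hnotMem x).mono fun n hn => iff_of_false hn (Set.notMem_empty x)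
  rw [measure_empty] at htendsto
  obtain ⟨n, ⟨ha, hb, hne⟩, hn⟩ :=
    (hab.and (htendsto.eventually_lt_const (pos_iff_ne_zero.2 hε))).exists
  exact ⟨n, a n, ha, b n, hb, hne, hn⟩

end IsExhaustingTowers

lemma setOf_ne_subset_of_tower {S : X ≃ᵐ X} {A B : Set X} {m : ℕ} {a b : X}
    (hST : ∀ x ∈ B \ A, ∀ i < m, S (T^[i] x) = T (T^[i] x)) (hSa : S (T^[m] a) = b) :
    {x | S x ≠ T x} ⊆ towerSupport T A m ∪ towerError T B m a b := by
  intro x hx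
  by_contra hxU
  simp only [towerError, Set.mem_union, not_or, Set.mem_compl_iff, not_not] at hxU
  obtain ⟨hxA, hxB, hxtop⟩ := hxU
  obtain ⟨i, hi, y, hy, rfl⟩ := Set.mem_iUnion₂.1 hxB
  have hyA : y ∉ A := fun hyA => hxA (Set.mem_iUnion₂.2 ⟨i, hi, y, hyA, rfl⟩)
  obtain rfl | hi := hi.eq_or_lt
  · obtain ⟨hya, hyb⟩ := Set.not_notMem.1 fun hne => hxtop ⟨⟨y, hy, rfl⟩, hne⟩
    rw [Set.mem_singleton_iff] at hya
    exact hx (by rw [hya, hSa, ← hya]; exact hyb.symm)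
  · exact hx (hST y ⟨hy, hyA⟩ i hi)

lemma measure_towerSupport_le (T : X ≃ᵐ X) (ν : Measure X) {A : Set X} (hA : MeasurableSet A)
    (m : ℕ) : ν (towerSupport T A m) ≤ (∑ i ∈ Finset.Iic m, ν.map T.symm^[i]) A := by
  have hsupp : towerSupport T A m = ⋃ i ∈ Finset.Iic m, T^[i] '' A := by
    simp only [towerSupport, Finset.mem_Iic]
  rw [hsupp, Measure.finsetSum_apply]
  refine (measure_biUnion_finset_le _ _).trans_eq (Finset.sum_congr rfl fun i _ => ?_)
  rw [Measure.map_apply (T.symm.measurable.iterate i) hA, image_iterate_eq_preimage]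

lemma IsTower.exists_odometer_measure_le [StandardBorelSpace X] {B : Set X} {m : ℕ}
    (hB : IsTower T B m) {a b : X} (ha : a ∈ B) (hb : b ∈ B) (hab : a ≠ b) (ν : Measure X)
    [IsFiniteMeasure ν] {ε : ENNReal} (hε : ε ≠ 0) :
    ∃ S ∈ odometers X, ν {x | S x ≠ T x} ≤ ε + ν (towerError T B m a b) := by
  have hab_fin : ({a, b} : Set X).Finite := Set.toFinite _
  obtain ⟨A, hAB, hA, hA', hlt⟩ := exists_uncountable_subset_measure_lt
    (hB.measurableSet.diff hab_fin.measurableSet)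
    (fun hc => hB.not_countable ((hc.union hab_fin.countable).mono (Set.subset_sdiff_union _ _)))
    (∑ i ∈ Finset.Iic m, ν.map T.symm^[i]) hε
  have hnotMem : ∀ c ∈ ({a, b} : Set X), c ∉ A := fun c hc hcA => (hAB hcA).2 hc
  obtain ⟨S, hS, hST, hSa⟩ := hB.exists_odometer (hAB.trans Set.sdiff_subset) hA hA'
    ⟨ha, hnotMem a (.inl rfl)⟩ ⟨hb, hnotMem b (.inr rfl)⟩ hab
  refine ⟨S, hS, ?_⟩
  calc ν {x | S x ≠ T x}
      ≤ ν (towerSupport T A m ∪ towerError T B m a b) :=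
        measure_mono (setOf_ne_subset_of_tower hST hSa)
    _ ≤ ν (towerSupport T A m) + ν (towerError T B m a b) := measure_union_le _ _
    _ ≤ ε + ν (towerError T B m a b) := by
        gcongr
        exact (measure_towerSupport_le T ν hA m).trans hlt.le

lemma HasRankAtMost.exists_odometer_measure_lt [StandardBorelSpace X] (h : HasRankAtMost T 1)
    (ν : Measure X) [IsFiniteMeasure ν] {ε : ENNReal} (hε : ε ≠ 0) :
    ∃ S ∈ odometers X, ν {x | S x ≠ T x} < ε := by
  obtain ⟨δ, hδ, hδε⟩ := exists_between (pos_iff_ne_zero.2 hε)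
  obtain ⟨B, m, hBm⟩ := h.exists_isExhaustingTowers
  obtain ⟨n, a, ha, b, hb, hab, hlt⟩ :=
    hBm.exists_measure_towerError_lt h.1 ν (tsub_pos_of_lt hδε).ne'
  obtain ⟨S, hS, hle⟩ := (hBm.isTower n).exists_odometer_measure_le ha hb hab ν hδ.ne'
  refine ⟨S, hS, hle.trans_lt ?_⟩
  calc δ + ν (towerError T (B n) (m n) a b) < δ + (ε - δ) :=
        ENNReal.add_lt_add_left hδε.ne_top hlt
    _ = ε := add_tsub_cancel_of_le hδε.le

end Refinement

section UniformTopology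

variable {X : Type*} [MeasurableSpace X]

lemma diffSet_subset_union (R S T : X ≃ᵐ X) : diffSet R T ⊆ diffSet R S ∪ diffSet S T := by
  intro x hx
  by_contra h
  simp only [diffSet, Set.mem_union, Set.mem_ofPred_eq, not_or, not_not] at h hx
  obtain ⟨⟨hRS, hRS'⟩, hST, hST'⟩ := h
  exact hx.elim (· (hST.trans hRS)) (· (hST'.trans hRS'))

lemma measure_diffSet_le (S T : X ≃ᵐ X) (ν : Measure X) :
    ν (diffSet S T) ≤ (ν + ν.map T.symm) {x | S x ≠ T x} := by
  have hsub : diffSet S T ⊆ {x | S x ≠ T x} ∪ T.symm ⁻¹' {x | S x ≠ T x} := by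
    refine Set.union_subset_union (fun x hx => Ne.symm hx) fun x hx hSx => hx ?_
    rw [eq_comm, S.symm_apply_eq, hSx, T.apply_symm_apply]
  rw [Measure.add_apply, T.symm.map_apply]
  exact (measure_mono hsub).trans (measure_union_le _ _)

lemma exists_measure_forall_mem_basicNhd {T T' : X ≃ᵐ X} {n : ℕ}
    {μ : Fin n → ProbabilityMeasure X} {ε : ℝ} (hT : T ∈ basicNhd T' μ ε) :
    ∃ (ν : Measure X) (δ : ENNReal), IsFiniteMeasure ν ∧ δ ≠ 0 ∧
      ∀ S, ν (diffSet S T) < δ → S ∈ basicNhd T' μ ε := by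
  have hgap : ∀ᶠ δ in 𝓝[>] (0 : ℝ), ∀ i, δ < ε - μ i (diffSet T T') :=
    eventually_all.2 fun i => nhdsWithin_le_nhds (eventually_lt_nhds (sub_pos.2 (hT i)))
  obtain ⟨δ, hδ, hδ₀⟩ := (hgap.and self_mem_nhdsWithin).exists
  refine ⟨∑ i, (μ i : Measure X), .ofReal δ, inferInstance, (ENNReal.ofReal_pos.2 hδ₀).ne',
    fun S hS i => ?_⟩
  rw [Measure.finsetSum_apply] at hS
  have hSi : (μ i : Measure X) (diffSet S T) < .ofReal δ :=
    (Finset.single_le_sum_of_canonicallyOrdered (Finset.mem_univ i)).trans_lt hS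
  rw [← ProbabilityMeasure.ennreal_coeFn_eq_coeFn_toMeasure,
    ENNReal.lt_ofReal_iff_toReal_lt ENNReal.coe_ne_top] at hSi
  have hle : (μ i (diffSet S T') : ℝ) ≤ μ i (diffSet S T) + μ i (diffSet T T') :=
    mod_cast ((μ i).apply_mono (diffSet_subset_union S T T')).trans (μ i).apply_union_le
  exact hle.trans_lt (lt_sub_iff_add_lt.1 (LT.lt.trans hSi (hδ i)))

lemma exists_measure_forall_mem_of_isOpen {U : Set (X ≃ᵐ X)} (hU : IsOpen[tau X] U) {T : X ≃ᵐ X}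
    (hT : T ∈ U) : ∃ (ν : Measure X) (ε : ENNReal), IsFiniteMeasure ν ∧ ε ≠ 0 ∧
      ∀ S, ν (diffSet S T) < ε → S ∈ U := by
  induction hU with
  | basic V hV =>
    obtain ⟨T', n, μ, ε, -, rfl⟩ := hV
    exact exists_measure_forall_mem_basicNhd hT
  | univ => exact ⟨0, 1, inferInstance, one_ne_zero, fun _ _ => trivial⟩
  | inter V W _ _ ihV ihW =>
    obtain ⟨ν, ε, _, hε, h⟩ := ihV hT.1
    obtain ⟨ν', ε', _, hε', h'⟩ := ihW hT.2
    refine ⟨ν + ν', min ε ε', inferInstance, (lt_min hε.bot_lt hε'.bot_lt).ne',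
      fun S hS => ⟨h S ?_, h' S ?_⟩⟩
    · exact (Measure.le_add_right le_rfl _).trans_lt (hS.trans_le (min_le_left ε ε'))
    · exact (Measure.le_add_left le_rfl _).trans_lt (hS.trans_le (min_le_right ε ε'))
  | sUnion 𝒱 _ ih =>
    obtain ⟨V, hV, hTV⟩ := hT
    obtain ⟨ν, ε, hν, hε, h⟩ := ih V hV hTV
    exact ⟨ν, ε, hν, hε, fun S hS => ⟨V, hV, h S hS⟩⟩

lemma mem_closure_tau {s : Set (X ≃ᵐ X)} {T : X ≃ᵐ X}
    (h : ∀ (ν : Measure X) [IsFiniteMeasure ν] (ε : ENNReal), ε ≠ 0 →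
      ∃ S ∈ s, ν {x | S x ≠ T x} < ε) :
    T ∈ closure[tau X] s := by
  let := tau X
  refine mem_closure_iff.2 fun U hU hTU => ?_
  obtain ⟨ν, ε, _, hε, hsub⟩ := exists_measure_forall_mem_of_isOpen hU hTU
  obtain ⟨S, hS, hlt⟩ := h (ν + ν.map T.symm) ε hε
  exact ⟨S, hsub S ((measure_diffSet_le S T ν).trans_lt hlt), hS⟩

variable (X) in
lemma rankSet_one_subset_closure_odometers [StandardBorelSpace X] :
    rankSet X 1 ⊆ closure[tau X] (odometers X) := fun _ hT =>
  mem_closure_tau fun ν _ _ hε => hT.1.exists_odometer_measure_lt ν hε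

end UniformTopology

end BorelAut

theorem theorem2p8 {X : Type*} [MeasurableSpace X] [StandardBorelSpace X] :
    closure[BorelAut.tau X] (BorelAut.rankSet X 1) =
      closure[BorelAut.tau X] (BorelAut.odometers X) := by
  let := BorelAut.tau X
  exact subset_antisymm
    (closure_minimal (BorelAut.rankSet_one_subset_closure_odometers X) isClosed_closure)
    (closure_mono (BorelAut.odometers_subset_rankSet_one X))
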